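/- Consider stochastic multi-armed bandits with $k\ge 1$ arms: successive pulls of arm $i$ give i.i.d. rewards from an unknown distribution on $[0,1]$ with mean $\mu_i$, and $\mu^*=\max_i\mu_i$. Write $I_t$ for the arm that an algorithm pulls in round $t$. The Nash regret of the algorithm after $T$ rounds is $$\mathrm{NR}_T=\mu^*-\Big(\prod_{t=1}^{T}\mathbb E[\mu_{I_t}]\Big)^{1/T}.$$ An algorithm is anytime if its choices use only its own random bits, the number $k$ of arms, and the arms and rewards of the past rounds, and not the horizon $T$. **Modified NCB with window $W$** (run for at most $W$ rounds; $c=3$). Let $n_i$, $\widehat\mu_i$ be the number of pulls and the empirical mean of arm $i$ since the run began ($\widehat\mu_i=0$ if $n_i=0$). While $\max_i n_i\widehat\mu_i\le 420c^2\log W$, pull an arm chosen uniformly at random. Afterwards, pull in every round an arm that maximizes $\widehat\mu_i+2c\sqrt{2\widehat\mu_i\log W/n_i}$ (read as $0$ if $n_i=0$), ties being broken by the smallest index. **Anytime algorithm.** Proceed in epochs of lengths $W=1,2,4,8,\dots$. In an epoch of length $W$, independently of everything else, with probability $1/W^2$ pull a uniformly random arm in each of the $W$ rounds of the epoch; with the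 remaining probability $1-1/W^2$, perform a fresh run of Modified NCB with window $W$. **Theorem.** There are absolute constants $C>0$ and $T_0$ such that for every $k\ge1$, every bandit instance with $k$ arms and every $T\ge T_0$, the Nash regret of this anytime algorithm satisfies $$\mathrm{NR}_T\le C\,\sqrt{\frac{k\log T}{T}}\;\log T .$$ -/

import Mathlib

open MeasureTheory ProbabilityTheory unitInterval

namespace NashBandit

noncomputable section

/-! ### Bandit instances, online algorithms, Nash regret -/

/-- A stochastic bandit instance with `k` arms: each arm is a probability distribution on the
interval `[0, 1]` (written `I`). -/
abbrev Instance (k : ℕ) : Type := Fin k → ProbabilityMeasure I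

/-- The mean reward of arm `i`. -/
def Instance.mean {k : ℕ} (ν : Instance k) (i : Fin k) : ℝ :=
  ∫ x, (x : ℝ) ∂(ν i : Measure I)

/-- The optimal mean, the maximum of the means of the arms. -/
def Instance.optMean {k : ℕ} (ν : Instance k) : ℝ := ⨆ i, ν.mean i

/-- What an algorithm has observed in `t` rounds: the arm pulled and the reward received, round
by round. -/
abbrev History (k t : ℕ) : Type := Fin t → Fin k × I

/-- The number of pulls of arm `i` recorded in a history. -/
def pullCount {k t : ℕ} (past : History k t) (i : Fin k) : ℕ :=
  (Finset.univ.filter fun s => (past s).1 = i).card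

/-- The sum of the rewards of arm `i` recorded in a history. -/
def rewardSum {k t : ℕ} (past : History k t) (i : Fin k) : ℝ :=
  ∑ s, if (past s).1 = i then ((past s).2 : ℝ) else 0

/-- The empirical mean of arm `i` in a history (`0` if the arm has not been pulled). -/
def empMean {k t : ℕ} (past : History k t) (i : Fin k) : ℝ :=
  rewardSum past i / pullCount past i

/-- A randomized anytime algorithm for `k` arms. Its own randomness is a random seed, which it
may reveal to itself gradually. The arm pulled after `t` rounds is a measurable function of the
seed and of the history of those rounds. Neither the horizon nor the instance is available. -/
structure AnytimeAlgorithm (k : ℕ) where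
  Seed : Type
  [measurableSpace : MeasurableSpace Seed]
  seedLaw : Measure Seed
  [isProbabilityMeasure : IsProbabilityMeasure seedLaw]
  select : (t : ℕ) → Seed → History k t → Fin k
  measurable_select : ∀ t, Measurable fun p : Seed × History k t => select t p.1 p.2

attribute [instance] AnytimeAlgorithm.measurableSpace AnytimeAlgorithm.isProbabilityMeasure

namespace AnytimeAlgorithm

variable {k : ℕ}

/-- The history of the first `t` rounds, when the seed is `ω` and the reward table is `Y`: the
entry `Y (i, s)` is the reward of arm `i` when it is pulled after `s` earlier pulls. -/
def history (A : AnytimeAlgorithm k) (ω : A.Seed) (Y : Fin k × ℕ → I) : (t : ℕ) → History k t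
  | 0 => Fin.elim0
  | t + 1 =>
    Fin.snoc (α := fun _ => Fin k × I) (history A ω Y t)
      (A.select t ω (history A ω Y t),
        Y (A.select t ω (history A ω Y t),
          pullCount (history A ω Y t) (A.select t ω (history A ω Y t))))

/-- The arm pulled in the round that follows the first `t` rounds. -/
def pulledArm (A : AnytimeAlgorithm k) (t : ℕ) (ω : A.Seed) (Y : Fin k × ℕ → I) : Fin k :=
  A.select t ω (A.history ω Y t)

/-- The probability measure induced by the algorithm and the instance: the seed and all entries
of the reward table are independent, and the entries of row `i` have the law of arm `i`. -/
def law (A : AnytimeAlgorithm k) (ν : Instance k) : Measure (A.Seed × (Fin k × ℕ → I)) :=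
  A.seedLaw.prod (Measure.infinitePi fun p : Fin k × ℕ => (ν p.1 : Measure I))

/-- The expected value of the mean of the arm pulled in the round after the first `t` rounds. -/
def expectedReward (A : AnytimeAlgorithm k) (ν : Instance k) (t : ℕ) : ℝ :=
  ∫ p, ν.mean (A.pulledArm t p.1 p.2) ∂(A.law ν)

/-- Nash regret after `T` rounds: the optimal mean minus the geometric mean of the expected
rewards of the `T` rounds. -/
def nashRegret (A : AnytimeAlgorithm k) (ν : Instance k) (T : ℕ) : ℝ :=
  ν.optMean - (∏ t ∈ Finset.range T, A.expectedReward ν t) ^ (1 / (T : ℝ))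

end AnytimeAlgorithm

/-! ### The Modified Nash Confidence Bound subroutine -/

/-- The absolute constant of the subroutine. -/
def cParam : ℝ := 3

/-- The Nash confidence bound of arm `i` for the window `W`. -/
def ncb {k t : ℕ} (W : ℕ) (past : History k t) (i : Fin k) : ℝ :=
  empMean past i +
    2 * cParam * Real.sqrt (2 * empMean past i * Real.log W / pullCount past i)

open Classical in
theorem maximizers_nonempty {k : ℕ} [NeZero k] (f : Fin k → ℝ) :
    (Finset.univ.filter fun i => ∀ j, f j ≤ f i).Nonempty := by
  obtain ⟨i, hi⟩ := Finite.exists_max f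
  exact ⟨i, by simpa using hi⟩

open Classical in
/-- The arm that maximizes `f`; ties are broken in favour of the smallest index. -/
def argmaxArm {k : ℕ} [NeZero k] (f : Fin k → ℝ) : Fin k :=
  (Finset.univ.filter fun i => ∀ j, f j ≤ f i).min' (maximizers_nonempty f)

/-- The arm that Modified NCB with window `W` pulls next, where `past` is the history since the
start of this run and `u` is a fresh uniform draw. As long as no arm's total reward exceeds
`420 c² log W` it explores uniformly (rewards are nonnegative, so that this phase does not resume
once it is over); then it pulls an arm with the highest Nash confidence bound. -/
def modifiedNCB {k t : ℕ} [NeZero k] (W : ℕ) (u : Fin k) (past : History k t) : Fin k :=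
  open Classical in
  if ∀ i, rewardSum past i ≤ 420 * cParam ^ 2 * Real.log W then u
  else argmaxArm (ncb W past)

/-! ### The anytime algorithm -/

/-- The window length of epoch `h`; the window is `1` at first, and doubles after each epoch. -/
def window (h : ℕ) : ℕ := 2 ^ h

/-- The number of rounds before epoch `h`, that is, `1 + 2 + ⋯ + 2 ^ (h - 1)`. -/
def epochStart (h : ℕ) : ℕ := ∑ z ∈ Finset.range h, window z

/-- The epoch that contains the round following the first `t` rounds. -/
def epochOf (t : ℕ) : ℕ := Nat.log 2 (t + 1)

theorem epochStart_eq (h : ℕ) : epochStart h + 1 = window h := by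
  induction h with
  | zero => simp [epochStart, window]
  | succ n ih =>
    unfold epochStart at ih ⊢
    rw [Finset.sum_range_succ, add_right_comm, ih]
    simp only [window]
    ring

theorem epochStart_le (t : ℕ) : epochStart (epochOf t) ≤ t := by
  have h := epochStart_eq (epochOf t)
  have h2 : window (epochOf t) ≤ t + 1 := Nat.pow_log_le_self 2 (Nat.succ_ne_zero t)
  omega

theorem lt_epochStart_succ (t : ℕ) : t < epochStart (epochOf t + 1) := by
  have h := epochStart_eq (epochOf t + 1)
  have h2 : t + 1 < window (epochOf t + 1) := Nat.lt_pow_succ_log_self one_lt_two (t + 1)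
  omega

/-- The part of a history that belongs to the current epoch. -/
def epochHistory {k t : ℕ} (past : History k t) : History k (t - epochStart (epochOf t)) :=
  fun s => past ⟨epochStart (epochOf t) + s, by omega⟩

/-- The probability `1 / W²` of uniform exploration in epoch `h`. -/
def exploreProb (h : ℕ) : I :=
  ⟨1 / (window h : ℝ) ^ 2, by positivity, by
    refine div_le_one_of_le₀ ?_ (by positivity)
    have : (1 : ℝ) ≤ window h := by exact_mod_cast Nat.one_le_two_pow
    nlinarith⟩

/-- The independent random choices of the algorithm: for each epoch `h` a flag, which is `true`
(uniform exploration) with probability `1 / W²`, and for each round a uniformly random arm. -/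
def seedMeasure (k : ℕ) [NeZero k] : Measure ((ℕ → Bool) × (ℕ → Fin k)) :=
  (Measure.infinitePi fun h => bernoulliMeasure true false (exploreProb h)).prod
    (Measure.infinitePi fun _ => (PMF.uniformOfFintype (Fin k)).toMeasure)

instance (k : ℕ) [NeZero k] : IsProbabilityMeasure (seedMeasure k) := by
  unfold seedMeasure
  infer_instance

/-- The arm pulled after `t` rounds: if the flag of the current epoch says so, the uniformly
random arm of this round; otherwise the arm that Modified NCB pulls, run with the window of the
current epoch on the observations of that epoch. -/
def anytimeSelect (k : ℕ) [NeZero k] (t : ℕ) (ω : (ℕ → Bool) × (ℕ → Fin k))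
    (past : History k t) : Fin k :=
  if ω.1 (epochOf t) = true then ω.2 t
  else modifiedNCB (window (epochOf t)) (ω.2 t) (epochHistory past)

theorem measurable_pullCount {k t : ℕ} (i : Fin k) :
    Measurable fun past : History k t => (pullCount past i : ℝ) := by
  have : (fun past : History k t => (pullCount past i : ℝ)) =
      fun past => ∑ s, if (past s).1 = i then (1 : ℝ) else 0 := by
    ext past
    simp [pullCount]
  rw [this]
  refine Finset.measurable_sum _ fun s _ => Measurable.ite ?_ measurable_const measurable_const
  exact (measurable_fst.comp (measurable_pi_apply s)) (measurableSet_singleton i)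

theorem measurable_rewardSum {k t : ℕ} (i : Fin k) :
    Measurable fun past : History k t => rewardSum past i := by
  unfold rewardSum
  refine Finset.measurable_sum _ fun s _ => Measurable.ite ?_ ?_ measurable_const
  · exact (measurable_fst.comp (measurable_pi_apply s)) (measurableSet_singleton i)
  · exact measurable_subtype_coe.comp (measurable_snd.comp (measurable_pi_apply s))

theorem measurable_ncb {k t : ℕ} (W : ℕ) (i : Fin k) :
    Measurable fun past : History k t => ncb W past i := by
  have h1 := measurable_pullCount (t := t) i
  have h2 := measurable_rewardSum (t := t) i
  unfold ncb empMean
  fun_prop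

theorem argmaxArm_eq_iff {k : ℕ} [NeZero k] (f : Fin k → ℝ) (i : Fin k) :
    argmaxArm f = i ↔ (∀ j, f j ≤ f i) ∧ ∀ i', (∀ j, f j ≤ f i') → i ≤ i' := by
  classical
  unfold argmaxArm
  rw [Finset.min'_eq_iff]
  simp

theorem measurable_argmaxArm {k : ℕ} [NeZero k] :
    Measurable (argmaxArm : (Fin k → ℝ) → Fin k) := by
  refine measurable_to_countable' fun i => ?_
  have hm : ∀ i : Fin k, MeasurableSet {f : Fin k → ℝ | ∀ j, f j ≤ f i} := fun i => by
    rw [Set.ofPred_forall]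
    exact MeasurableSet.iInter fun j =>
      measurableSet_le (measurable_pi_apply j) (measurable_pi_apply i)
  have : argmaxArm ⁻¹' {i} = {f : Fin k → ℝ | ∀ j, f j ≤ f i} ∩
      ⋂ i' : Fin k, ({f : Fin k → ℝ | ∀ j, f j ≤ f i'}ᶜ ∪ {_f | i ≤ i'}) := by
    ext f
    simp only [Set.mem_preimage, Set.mem_singleton_iff, argmaxArm_eq_iff, Set.mem_inter_iff,
      Set.mem_iInter, Set.mem_union, Set.mem_compl_iff, Set.mem_ofPred_eq, imp_iff_not_or]
  rw [this]
  exact (hm i).inter (MeasurableSet.iInter fun i' => (hm i').compl.union (MeasurableSet.const _))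

theorem measurable_modifiedNCB {k t : ℕ} [NeZero k] (W : ℕ) :
    Measurable fun p : Fin k × History k t => modifiedNCB W p.1 p.2 := by
  classical
  unfold modifiedNCB
  refine Measurable.ite ?_ measurable_fst ?_
  · rw [Set.ofPred_forall]
    exact MeasurableSet.iInter fun i =>
      measurableSet_le ((measurable_rewardSum i).comp measurable_snd) measurable_const
  · exact measurable_argmaxArm.comp
      (measurable_pi_lambda _ fun i => (measurable_ncb W i).comp measurable_snd)

theorem measurable_epochHistory {k t : ℕ} :
    Measurable fun past : History k t => epochHistory past := by
  unfold epochHistory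
  exact measurable_pi_lambda _ fun s => measurable_pi_apply _

theorem measurable_anytimeSelect (k : ℕ) [NeZero k] (t : ℕ) :
    Measurable fun p : ((ℕ → Bool) × (ℕ → Fin k)) × History k t =>
      anytimeSelect k t p.1 p.2 := by
  unfold anytimeSelect
  generalize hW : window (epochOf t) = W
  have hset : MeasurableSet {p : ((ℕ → Bool) × (ℕ → Fin k)) × History k t |
      p.1.1 (epochOf t) = true} := by
    have hf : Measurable fun p : ((ℕ → Bool) × (ℕ → Fin k)) × History k t =>
      p.1.1 (epochOf t) := by fun_prop
    exact measurableSet_eq_fun hf measurable_const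
  have hdraw : Measurable fun p : ((ℕ → Bool) × (ℕ → Fin k)) × History k t => p.1.2 t := by
    fun_prop
  have hpast : Measurable fun p : ((ℕ → Bool) × (ℕ → Fin k)) × History k t =>
      (p.1.2 t, epochHistory p.2) :=
    hdraw.prodMk (measurable_epochHistory.comp measurable_snd)
  have hncb := (measurable_modifiedNCB (k := k) (t := t - epochStart (epochOf t)) W).comp hpast
  exact Measurable.ite hset hdraw hncb

/-- The anytime algorithm: epochs with doubling windows; in an epoch with window `W`, uniform
exploration throughout with probability `1 / W²`, and otherwise a fresh run of Modified NCB. -/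
def anytimeNCB (k : ℕ) [NeZero k] : AnytimeAlgorithm k where
  Seed := (ℕ → Bool) × (ℕ → Fin k)
  seedLaw := seedMeasure k
  select := anytimeSelect k
  measurable_select := measurable_anytimeSelect k

end

end NashBandit

/-!
The Nash regret of the anytime algorithm is at most `O(log T / T)` times its ordinary expected
regret, and the ordinary expected regret is `O(√(k T log T))`.

*Nash regret from expected regret* (`sub_rpow_prod_le`). Write `m` for the optimal mean and `a t`
for the expected mean of the arm of round `t`. The forced uniform exploration with probability
`1 / W²` gives `a t ≥ m / (k W²)` (`le_expectedReward`), which is at least `m / T³` when `k ≤ T`;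
for `k > T` the claim is trivial. On `[T⁻³, 1]` one has `-log x ≤ 6 log T (1 - x)`, so that
`m - (∏ a t) ^ (1 / T) ≤ (m / T) ∑ log (m / a t) ≤ (6 log T / T) ∑ (m - a t)`.

*Expected regret of an epoch* (`sum_expected_regret_le`). Let `W` be the window and `L = log W`.
With probability `1 - O(k / W²)` the flag is not set and all blocks of consecutive uniform draws
and of consecutive entries of the rows of the reward table satisfy Chernoff bounds (`RegularSeq`).
The union bound runs over all starting positions of the blocks, since the rewards of an epoch
start in a row of the table where the earlier epochs stopped. The rest is deterministic
(`sum_regret_le`): uniform exploration lasts `O(k L / m)` rounds, which cost `O(k L)`; when it is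
over, an optimal arm has been pulled at least `600 L / m` times, so that its confidence bound stays
above `m` from then on (`le_ncb_index`); hence a pull of an arm after `n ≥ 1` earlier pulls costs
`O(√(L / n))` (`sub_le_of_le_ncb_index`), and an arm that has not been pulled is never chosen
unless `m = 0`. These costs add up to `O(√(k W L))`. Since the windows double, the sum over the
epochs is dominated by the last one (`sum_range_expected_regret_le`).
-/

namespace NashBandit

/-! ### Chernoff bounds for sums of independent variables with values in `[0, 1]` -/

section Chernoff

variable {Ω : Type*} [MeasurableSpace Ω] {P : Measure Ω} [IsProbabilityMeasure P]

theorem integrable_of_mem_Icc {X : Ω → ℝ} (hX : Measurable X) {a b : ℝ}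
    (hab : ∀ ω, X ω ∈ Set.Icc a b) : Integrable X P :=
  Integrable.of_mem_Icc a b hX.aemeasurable (Filter.Eventually.of_forall hab)

theorem mgf_le_exp_of_mem_Icc {X : Ω → ℝ} (hX : Measurable X)
    (h01 : ∀ ω, X ω ∈ Set.Icc (0 : ℝ) 1) (t : ℝ) :
    mgf X P t ≤ Real.exp ((∫ ω, X ω ∂P) * (Real.exp t - 1)) := by
  have hi : Integrable X P := integrable_of_mem_Icc hX h01
  -- the chord of the convex function `x ↦ exp (t * x)` over `[0, 1]`
  have hchord : ∀ x ∈ Set.Icc (0 : ℝ) 1, Real.exp (t * x) ≤ 1 + x * (Real.exp t - 1) := by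
    intro x hx
    have h := convexOn_exp.2 (Set.mem_univ 0) (Set.mem_univ t) (sub_nonneg.2 hx.2) hx.1
      (by ring)
    simp only [smul_eq_mul, mul_zero, zero_add, Real.exp_zero, mul_one] at h
    rw [mul_comm x t] at h
    linarith
  have h1 : mgf X P t ≤ ∫ ω, (1 + X ω * (Real.exp t - 1)) ∂P := by
    refine integral_mono_of_nonneg (Filter.Eventually.of_forall fun ω => (Real.exp_pos _).le)
      ((integrable_const _).add (hi.mul_const _))
      (Filter.Eventually.of_forall fun ω => hchord _ (h01 ω))
  rw [integral_add (integrable_const _) (hi.mul_const _), integral_mul_const] at h1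
  simp only [integral_const, probReal_univ, smul_eq_mul, mul_one] at h1
  refine h1.trans ?_
  linarith [Real.add_one_le_exp ((∫ ω, X ω ∂P) * (Real.exp t - 1))]

/-- A partial sum `S` of `m` terms of mean `p` is close to its expectation `m p`: the deviation
below is of the order of the standard deviation `√(m p)`, the one above is bounded both
multiplicatively and in the additive way of Hoeffding's inequality. The number `L` sets the
confidence level. -/
structure RegularSum (S : ℝ) (m : ℕ) (p L : ℝ) : Prop where
  lower : m * p - Real.sqrt (8 * (m * p) * L) ≤ S
  upper_mul : S ≤ 2 * (m * p) + 4 * L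
  upper_add : S ≤ m * p + 4 * Real.sqrt (m * L)

theorem exp_sub_one_le_of_nonpos {t : ℝ} (ht : t ≤ 0) : Real.exp t - 1 ≤ t + t ^ 2 / 2 := by
  have h := Real.quadratic_le_exp_of_nonneg (neg_nonneg.2 ht)
  have h2 : Real.exp t * Real.exp (-t) = 1 := by rw [← Real.exp_add]; simp
  have hpos := Real.exp_pos t
  have h3 : Real.exp t * (1 + -t + (-t) ^ 2 / 2) ≤ 1 := by
    exact (mul_le_mul_of_nonneg_left h hpos.le).trans_eq h2
  have hq : 0 < 1 + -t + (-t) ^ 2 / 2 := by nlinarith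
  by_contra hc
  have : (1 + t + t ^ 2 / 2) * (1 + -t + (-t) ^ 2 / 2) <
      Real.exp t * (1 + -t + (-t) ^ 2 / 2) := by
    apply mul_lt_mul_of_pos_right _ hq
    linarith
  nlinarith [sq_nonneg (t ^ 2)]

variable {X : ℕ → Ω → ℝ} {p L : ℝ}

theorem mgf_sum_le_exp (hX : ∀ j, Measurable (X j)) (h01 : ∀ j ω, X j ω ∈ Set.Icc (0 : ℝ) 1)
    (hind : iIndepFun X P) (hp : ∀ j, ∫ ω, X j ω ∂P = p) (s : Finset ℕ) (t : ℝ) :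
    mgf (∑ j ∈ s, X j) P t ≤ Real.exp (s.card * p * (Real.exp t - 1)) := by
  rw [hind.mgf_sum hX, mul_assoc, ← nsmul_eq_mul, Real.exp_nsmul, ← Finset.prod_const]
  exact Finset.prod_le_prod (fun j _ => mgf_nonneg)
    fun j _ => hp j ▸ mgf_le_exp_of_mem_Icc (hX j) (h01 j) t

theorem measureReal_not_regularSum_le (hX : ∀ j, Measurable (X j))
    (h01 : ∀ j ω, X j ω ∈ Set.Icc (0 : ℝ) 1) (hind : iIndepFun X P)
    (hp : ∀ j, ∫ ω, X j ω ∂P = p) (hL : 0 ≤ L) (s : Finset ℕ) :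
    P.real {ω | ¬ RegularSum (∑ j ∈ s, X j ω) s.card p L} ≤ 3 * Real.exp (-(4 * L)) := by
  have hSm : Measurable (∑ j ∈ s, X j) := by fun_prop
  have hS0 : ∀ ω, 0 ≤ (∑ j ∈ s, X j) ω := fun ω => by
    simpa using Finset.sum_nonneg fun j _ => (h01 j ω).1
  have hSn : ∀ ω, (∑ j ∈ s, X j) ω ≤ s.card := fun ω => by
    simpa using Finset.sum_le_card_nsmul s (fun j => X j ω) 1 fun j _ => (h01 j ω).2
  have hint : ∀ t : ℝ, Integrable (fun ω => Real.exp (t * (∑ j ∈ s, X j) ω)) P := fun t => by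
    refine integrable_of_mem_Icc (a := 0) (b := Real.exp (|t| * s.card)) (by fun_prop) fun ω =>
      ⟨(Real.exp_pos _).le, Real.exp_le_exp.2 ?_⟩
    exact mul_le_mul (le_abs_self t) (hSn ω) (hS0 ω) (abs_nonneg t)
  have hmgf := mgf_sum_le_exp hX h01 hind hp s
  have hp0 : 0 ≤ p := hp 0 ▸ integral_nonneg fun ω => (h01 0 ω).1
  have hp1 : p ≤ 1 := by
    rw [← hp 0]
    refine (integral_mono (integrable_of_mem_Icc (hX 0) (h01 0)) (integrable_const 1)
      fun ω => (h01 0 ω).2).trans ?_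
    simp
  have hn0 : (0 : ℝ) ≤ s.card := Nat.cast_nonneg _
  have hM0 : 0 ≤ s.card * p := by positivity
  have hMn : s.card * p ≤ s.card := mul_le_of_le_one_right hn0 hp1
  have hsum : ∀ ω, (∑ j ∈ s, X j) ω = ∑ j ∈ s, X j ω := fun ω => by simp
  simp only [← hsum]
  generalize (∑ j ∈ s, X j) = S at *
  generalize hn : (s.card : ℝ) = n at *
  generalize hM : n * p = M at *
  have hlow : P.real {ω | S ω < M - Real.sqrt (8 * M * L)} ≤ Real.exp (-(4 * L)) := by
    rcases hM0.eq_or_lt with h0 | hpos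
    · have : {ω | S ω < M - Real.sqrt (8 * M * L)} = ∅ := by
        ext ω; simpa [← h0] using hS0 ω
      rw [this]; simpa using (Real.exp_pos _).le
    set δ := Real.sqrt (8 * M * L) with hδ
    have hδ2 : δ ^ 2 = 8 * M * L := Real.sq_sqrt (by positivity)
    have hδ0 : 0 ≤ δ := Real.sqrt_nonneg _
    have ht : -(δ / M) ≤ 0 := by simpa using (by positivity : 0 ≤ δ / M)
    refine (measureReal_mono fun ω (hω : S ω < M - δ) => hω.le).trans
      ((measure_le_le_exp_mul_mgf (M - δ) ht (hint _)).trans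
      ((mul_le_mul_of_nonneg_left (hmgf _) (Real.exp_pos _).le).trans ?_))
    rw [← Real.exp_add]
    refine Real.exp_le_exp.2 ?_
    have h1 := mul_le_mul_of_nonneg_left (exp_sub_one_le_of_nonpos ht) hpos.le
    have h2 : - -(δ / M) * (M - δ) + M * (-(δ / M) + (-(δ / M)) ^ 2 / 2) = -(δ ^ 2 / (2 * M)) := by
      field_simp; ring
    have h3 : δ ^ 2 / (2 * M) = 4 * L := by rw [hδ2]; field_simp; ring
    linarith
  have hup1 : P.real {ω | 2 * M + 4 * L < S ω} ≤ Real.exp (-(4 * L)) := by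
    refine (measureReal_mono fun ω (hω : 2 * M + 4 * L < S ω) => hω.le).trans
      ((measure_ge_le_exp_mul_mgf (2 * M + 4 * L) zero_le_one (hint _)).trans
      ((mul_le_mul_of_nonneg_left (hmgf _) (Real.exp_pos _).le).trans ?_))
    rw [← Real.exp_add]
    refine Real.exp_le_exp.2 ?_
    nlinarith [Real.exp_one_lt_d9]
  have hup2 : P.real {ω | M + 4 * Real.sqrt (n * L) < S ω} ≤ Real.exp (-(4 * L)) := by
    set x := 4 * Real.sqrt (n * L) with hx
    have hx0 : 0 ≤ x := by positivity
    by_cases hxn : n ≤ x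
    -- a sum of `n` terms in `[0, 1]` does not exceed `n`
    · have : {ω | M + x < S ω} = ∅ := by
        ext ω
        simpa using (hSn ω).trans (by linarith)
      rw [this]; simpa using (Real.exp_pos _).le
    push Not at hxn
    have hnpos : 0 < n := hx0.trans_lt hxn
    have hx2 : x ^ 2 = 16 * (n * L) := by rw [hx, mul_pow, Real.sq_sqrt (by positivity)]; ring
    have ht : 0 ≤ x / (2 * n) := by positivity
    have ht1 : x / (2 * n) ≤ 1 := by rw [div_le_one (by positivity)]; linarith
    refine (measureReal_mono fun ω (hω : M + x < S ω) => hω.le).trans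
      ((measure_ge_le_exp_mul_mgf (M + x) ht (hint _)).trans
      ((mul_le_mul_of_nonneg_left (hmgf _) (Real.exp_pos _).le).trans ?_))
    rw [← Real.exp_add]
    refine Real.exp_le_exp.2 ?_
    have h1 := (abs_le.1 (Real.abs_exp_sub_one_sub_id_le (abs_le.2 ⟨by linarith, ht1⟩))).2
    have h2 : M * (Real.exp (x / (2 * n)) - 1) ≤ M * (x / (2 * n)) + n * (x / (2 * n)) ^ 2 := by
      have h4 := mul_le_mul_of_nonneg_left h1 hM0
      have h5 := mul_le_mul_of_nonneg_right hMn (sq_nonneg (x / (2 * n)))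
      linarith
    have h3 : -(x / (2 * n)) * (M + x) + (M * (x / (2 * n)) + n * (x / (2 * n)) ^ 2) =
        -(x ^ 2 / (4 * n)) := by field_simp; ring
    have h4 : x ^ 2 / (4 * n) = 4 * L := by rw [hx2]; field_simp; ring
    linarith
  refine (measureReal_mono (s₂ := {ω | S ω < M - Real.sqrt (8 * M * L)} ∪
    ({ω | 2 * M + 4 * L < S ω} ∪ {ω | M + 4 * Real.sqrt (n * L) < S ω})) ?_).trans ?_
  · intro ω hω
    by_contra hc
    simp only [Set.mem_union, Set.mem_ofPred_eq, not_or, not_lt] at hc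
    exact hω ⟨by rw [hn, hM]; exact hc.1, by rw [hn, hM]; exact hc.2.1, by rw [hn, hM]; exact hc.2.2⟩
  · refine (measureReal_union_le _ _).trans ?_
    linarith [measureReal_union_le (μ := P) {ω | 2 * M + 4 * L < S ω}
      {ω | M + 4 * Real.sqrt (n * L) < S ω}]

end Chernoff

/-- Every block of at most `W` consecutive terms of `x` that starts before position `W` has a
regular sum, at the confidence level `log W`. -/
def RegularSeq (x : ℕ → ℝ) (p : ℝ) (W : ℕ) : Prop :=
  ∀ a ∈ Finset.range W, ∀ m ∈ Finset.range (W + 1),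
    RegularSum (∑ j ∈ Finset.range m, x (a + j)) m p (Real.log W)

theorem measureReal_not_regularSeq_le {Ω : Type*} [MeasurableSpace Ω] {P : Measure Ω}
    [IsProbabilityMeasure P] {X : ℕ → Ω → ℝ} {p : ℝ} (hX : ∀ j, Measurable (X j))
    (h01 : ∀ j ω, X j ω ∈ Set.Icc (0 : ℝ) 1) (hind : iIndepFun X P)
    (hp : ∀ j, ∫ ω, X j ω ∂P = p) {W : ℕ} (hW : 1 ≤ W) :
    P.real {ω | ¬ RegularSeq (fun j => X j ω) p W} ≤ 6 / (W : ℝ) ^ 2 := by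
  have hW0 : (1 : ℝ) ≤ W := by exact_mod_cast hW
  have hexp : Real.exp (-(4 * Real.log W)) = 1 / (W : ℝ) ^ 4 := by
    rw [Real.exp_neg, mul_comm, Real.exp_mul, Real.exp_log (by linarith), one_div]
    norm_cast
  have hset : {ω | ¬ RegularSeq (fun j => X j ω) p W} =
      ⋃ a ∈ Finset.range W, ⋃ m ∈ Finset.range (W + 1),
        {ω | ¬ RegularSum (∑ j ∈ Finset.range m, X (a + j) ω) m p (Real.log W)} := by
    ext ω
    simp only [RegularSeq, Set.mem_ofPred_eq, Set.mem_iUnion, not_forall, exists_prop]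
  rw [hset]
  have hone : ∀ a m : ℕ,
      P.real {ω | ¬ RegularSum (∑ j ∈ Finset.range m, X (a + j) ω) m p (Real.log W)} ≤
        3 * (1 / (W : ℝ) ^ 4) := fun a m => by
    have := measureReal_not_regularSum_le (X := fun j => X (a + j)) (fun j => hX _)
      (fun j => h01 _) (hind.precomp (add_right_injective a)) (fun j => hp _)
      (Real.log_nonneg hW0) (Finset.range m)
    rwa [Finset.card_range, hexp] at this
  calc _ ≤ ∑ a ∈ Finset.range W, ∑ m ∈ Finset.range (W + 1), 3 * (1 / (W : ℝ) ^ 4) :=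
        (measureReal_biUnion_finset_le _ _).trans (Finset.sum_le_sum fun a _ =>
          (measureReal_biUnion_finset_le _ _).trans (Finset.sum_le_sum fun m _ => hone a m))
    _ = 3 * (1 + 1 / W) / (W : ℝ) ^ 2 := by
        simp only [Finset.sum_const, Finset.card_range, nsmul_eq_mul, Nat.cast_add, Nat.cast_one]
        field_simp
    _ ≤ 6 / (W : ℝ) ^ 2 := by
        gcongr
        have : 1 / (W : ℝ) ≤ 1 := by rw [div_le_one (by linarith)]; exact hW0
        linarith

/-! ### Regret of a run of Modified NCB on regular data -/

/-- The number of pulls of arm `i` before round `t`, when arm `A s` is pulled in round `s`. -/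
def pulls {k : ℕ} (A : ℕ → Fin k) (t : ℕ) (i : Fin k) : ℕ :=
  ((Finset.range t).filter fun s => A s = i).card

/-- The total reward of arm `i` before round `t`, when arm `A s` is pulled in round `s` and the
`j`-th pull of arm `i` gives the reward `y i j`. -/
def gain {k : ℕ} (A : ℕ → Fin k) (y : Fin k → ℕ → ℝ) (t : ℕ) (i : Fin k) : ℝ :=
  ∑ j ∈ Finset.range (pulls A t i), y i j

section Pulls

variable {k : ℕ} {A : ℕ → Fin k} {y : Fin k → ℕ → ℝ}

theorem pulls_zero (i : Fin k) : pulls A 0 i = 0 := by simp [pulls]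

theorem pulls_succ (t : ℕ) (i : Fin k) :
    pulls A (t + 1) i = pulls A t i + if A t = i then 1 else 0 := by
  simp only [pulls, Finset.card_filter, Finset.sum_range_succ]

theorem pulls_le (t : ℕ) (i : Fin k) : pulls A t i ≤ t :=
  (Finset.card_filter_le _ _).trans (Finset.card_range t).le

theorem pulls_mono (i : Fin k) : Monotone fun t => pulls A t i := fun _ _ h =>
  Finset.card_le_card (Finset.filter_subset_filter _ (Finset.range_mono h))

theorem pulls_add (s t : ℕ) (i : Fin k) :
    pulls A (s + t) i = pulls A s i + pulls (fun r => A (s + r)) t i := by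
  induction t with
  | zero => simp [pulls_zero]
  | succ t ih => rw [← add_assoc, pulls_succ, pulls_succ, ih, add_assoc]

theorem sum_pulls (t : ℕ) : ∑ i, pulls A t i = t := by
  unfold pulls
  rw [← Finset.card_eq_sum_card_fiberwise fun _ _ => Finset.mem_coe.2 (Finset.mem_univ _),
    Finset.card_range]

theorem pulls_eq_of_forall_lt {U : ℕ → Fin k} {t : ℕ} (h : ∀ s < t, A s = U s) (i : Fin k) :
    pulls A t i = pulls U t i := by
  unfold pulls
  congr 1
  refine Finset.filter_congr fun s hs => ?_
  rw [h s (Finset.mem_range.1 hs)]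

theorem cast_pulls (t : ℕ) (i : Fin k) :
    (pulls A t i : ℝ) = ∑ s ∈ Finset.range t, if A s = i then 1 else 0 := by
  simp [pulls]

/-- The total reward of an arm, accumulated round by round. -/
theorem gain_eq_sum (t : ℕ) (i : Fin k) :
    gain A y t i = ∑ s ∈ Finset.range t, if A s = i then y i (pulls A s i) else 0 := by
  induction t with
  | zero => simp [gain, pulls_zero]
  | succ t ih =>
    rw [Finset.sum_range_succ, ← ih, gain, gain, pulls_succ]
    split_ifs with h
    · rw [Finset.sum_range_succ]
    · simp

end Pulls

theorem sqrt_mul_le_add {x L : ℝ} (hx : 0 ≤ x) (hL : 0 ≤ L) :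
    Real.sqrt (8 * x * L) ≤ x / 4 + 8 * L := by
  refine Real.sqrt_le_iff.2 ⟨by positivity, ?_⟩
  nlinarith [sq_nonneg (x / 4 - 8 * L)]

theorem ncb_index_eq (R L : ℝ) (n : ℕ) :
    R / n + 2 * cParam * Real.sqrt (2 * (R / n) * L / n) =
      (R + 6 * Real.sqrt (2 * R * L)) / n := by
  have h : 2 * (R / n) * L / n = 2 * R * L / (n : ℝ) ^ 2 := by
    rw [mul_div_assoc', div_mul_eq_mul_div, div_div, sq]
  rw [h, Real.sqrt_div' _ (by positivity), Real.sqrt_sq (by positivity), cParam]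
  ring

/-- The confidence bound of an arm with mean `p` is at least `p`, once the arm has been pulled
sufficiently often. -/
theorem le_ncb_index {R p L : ℝ} {n : ℕ} (hL : 0 < L) (hreg : RegularSum R n p L)
    (hn : 600 * L ≤ n * p) : p ≤ (R + 6 * Real.sqrt (2 * R * L)) / n := by
  have hn0 : (0 : ℝ) < n := by
    rcases Nat.eq_zero_or_pos n with rfl | h
    · simp at hn; linarith
    · exact_mod_cast h
  rw [le_div_iff₀ hn0, mul_comm]
  have hlow := hreg.lower
  generalize (n : ℝ) * p = z at *
  have hz : 0 < z := by linarith
  have h1 : Real.sqrt (8 * z * L) ≤ z / 8 :=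
    Real.sqrt_le_iff.2 ⟨by positivity, by nlinarith⟩
  have h2 : Real.sqrt (8 * z * L) ≤ 6 * Real.sqrt (2 * R * L) := by
    have : (6 : ℝ) = Real.sqrt 36 := by
      rw [show (36 : ℝ) = 6 ^ 2 by norm_num, Real.sqrt_sq (by norm_num)]
    rw [this, ← Real.sqrt_mul (by norm_num)]
    refine Real.sqrt_le_sqrt ?_
    nlinarith
  linarith

/-- If the confidence bound of an arm is at least `q`, then the mean `p` of that arm falls short
of `q` by an amount that is paid for by the increase of the potential `√n`. -/
theorem sub_le_of_le_ncb_index {R p q L : ℝ} {n : ℕ} (hL : 0 ≤ L) (hp : 0 ≤ p)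
    (hreg : RegularSum R n p L) (hRn : R ≤ n)
    (hq : q ≤ (R + 6 * Real.sqrt (2 * R * L)) / n) :
    q - p ≤ 37 * Real.sqrt L * (Real.sqrt ((n + 1 : ℕ) : ℝ) - Real.sqrt n) := by
  have hsL := Real.sqrt_nonneg L
  rcases Nat.eq_zero_or_pos n with rfl | hn
  -- the confidence bound reads `0` for an arm that has not been pulled, so that `q ≤ 0`
  · simp at hq ⊢; linarith [hq, mul_nonneg (by norm_num : (0 : ℝ) ≤ 37) hsL]
  have hn1 : (1 : ℝ) ≤ n := by exact_mod_cast hn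
  have hn0 : (0 : ℝ) < n := by linarith
  rw [le_div_iff₀ hn0] at hq
  have hup := hreg.upper_add
  have h1 : Real.sqrt (2 * R * L) ≤ 17 / 12 * Real.sqrt (n * L) := by
    rw [show (17 / 12 : ℝ) = Real.sqrt ((17 / 12) ^ 2) by rw [Real.sqrt_sq (by norm_num)],
      ← Real.sqrt_mul (by norm_num)]
    refine Real.sqrt_le_sqrt ?_
    nlinarith [mul_nonneg hn0.le hL, mul_le_mul_of_nonneg_right hRn hL]
  rw [Real.sqrt_mul hn0.le] at hup h1
  push_cast
  have ha : Real.sqrt n ^ 2 = n := Real.sq_sqrt hn0.le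
  have hb : Real.sqrt (n + 1 : ℝ) ^ 2 = n + 1 := Real.sq_sqrt (by linarith)
  have ha0 : 0 < Real.sqrt n := Real.sqrt_pos.2 hn0
  have hb0 : 0 ≤ Real.sqrt (n + 1 : ℝ) := Real.sqrt_nonneg _
  have hba : Real.sqrt (n + 1 : ℝ) ≤ 3 / 2 * Real.sqrt n :=
    Real.sqrt_le_iff.2 ⟨by positivity, by nlinarith⟩
  generalize Real.sqrt (n : ℝ) = a at *
  generalize Real.sqrt (n + 1 : ℝ) = b at *
  have hd : a * (q - p) ≤ 25 / 2 * Real.sqrt L := by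
    refine le_of_mul_le_mul_left (a := a) ?_ ha0
    have h2 : a * (a * (q - p)) = q * n - n * p := by rw [← ha]; ring
    linarith
  have hgap : 1 ≤ 5 / 2 * (a * (b - a)) := by
    have : 0 ≤ b - a := by nlinarith
    nlinarith
  refine le_of_mul_le_mul_left (a := a) ?_ ha0
  nlinarith

section Run

variable {k W : ℕ} [NeZero k] {A U : ℕ → Fin k} {y : Fin k → ℕ → ℝ} {μ : Fin k → ℝ} {b : Fin k}

/-- The regret of Modified NCB over its whole window, on data that satisfy the concentration
bounds: `O(k log W)` from the uniform exploration, plus the sum of the confidence widths, which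
is `O(√(k W log W))`. -/
theorem sum_regret_le (hW : 2 ≤ W) (hμ : ∀ i, μ i ∈ Set.Icc (0 : ℝ) 1) (hb : ∀ i, μ i ≤ μ b)
    (hy : ∀ i j, y i j ∈ Set.Icc (0 : ℝ) 1)
    (hregU : ∀ i, ∀ m ≤ W, RegularSum (pulls U m i) m (1 / k) (Real.log W))
    (hregy : ∀ i, ∀ m ≤ W, RegularSum (∑ j ∈ Finset.range m, y i j) m (μ i) (Real.log W))
    (hA : ∀ t < W, A t = open Classical in
      if ∀ i, gain A y t i ≤ 420 * cParam ^ 2 * Real.log W then U t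
      else argmaxArm fun i => gain A y t i / pulls A t i + 2 * cParam *
        Real.sqrt (2 * (gain A y t i / pulls A t i) * Real.log W / pulls A t i)) :
    ∑ t ∈ Finset.range W, (μ b - μ (A t)) ≤
      1 + 6745 * k * Real.log W + 37 * Real.sqrt (Real.log W) * Real.sqrt (k * W) := by
  classical
  have hL : 0 < Real.log W := Real.log_pos (by exact_mod_cast hW)
  have hk : (0 : ℝ) < k := by exact_mod_cast Nat.pos_of_ne_zero (NeZero.ne k)
  generalize Real.log W = L at *
  set explore : ℕ → Prop := fun t => ∀ i, gain A y t i ≤ 420 * cParam ^ 2 * L with hexplore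
  have hmono : ∀ s t, s ≤ t → explore t → explore s := fun s t hst h i =>
    (Finset.sum_le_sum_of_subset_of_nonneg (Finset.range_mono (pulls_mono i hst))
      fun j _ _ => (hy i j).1).trans (h i)
  have hgain : ∀ i t, t ≤ W → RegularSum (gain A y t i) (pulls A t i) (μ i) L := fun i t ht =>
    hregy i _ ((pulls_le t i).trans ht)
  have hpullsU : ∀ t ≤ W, (∀ s < t, explore s) → ∀ i, pulls A t i = pulls U t i :=
    fun t ht h => pulls_eq_of_forall_lt fun s hs => by
      rw [hA s (hs.trans_le ht), if_pos (h s hs)]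
  have hμb0 := (hμ b).1
  have hμb1 := (hμ b).2
  -- exploration is short
  have hshort : ∀ t ≤ W, explore t → t * μ b ≤ 6745 * k * L := by
    intro t ht h
    have hu := (hregU b t ht).lower
    rw [← hpullsU t ht (fun s hs => hmono s t hs.le h) b] at hu
    have hg := (hgain b t ht).lower
    have hθ := h b
    have hx : 0 ≤ (t : ℝ) * (1 / k) := by positivity
    have ht' : (t : ℝ) = k * (t * (1 / k)) := by field_simp
    rw [ht']
    generalize (t : ℝ) * (1 / k) = x at *
    have hn : (0 : ℝ) ≤ pulls A t b := Nat.cast_nonneg _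
    generalize (pulls A t b : ℝ) = n at *
    have h1 := sqrt_mul_le_add hx hL.le
    have h2 := sqrt_mul_le_add (mul_nonneg hn hμb0) hL.le
    have h3 : (x * (3 / 4) - 8 * L) * μ b ≤ n * μ b :=
      mul_le_mul_of_nonneg_right (by linarith) hμb0
    rw [cParam] at hθ
    have h4 : x * μ b ≤ 6745 * L := by nlinarith [mul_le_of_le_one_right hL.le hμb1]
    nlinarith [mul_le_mul_of_nonneg_left h4 hk.le]
  -- when exploration is over, the optimal arm has been pulled sufficiently often
  have hlong : ∀ t ≤ W, ¬ explore t → 600 * L ≤ pulls A t b * μ b := by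
    intro t ht h
    -- `s` is the first round after exploration
    obtain ⟨s, hst, hs, hsmin⟩ : ∃ s ≤ t, ¬ explore s ∧ ∀ r < s, explore r := by
      have hex : ∃ s, ¬ explore s := ⟨t, h⟩
      exact ⟨Nat.find hex, Nat.find_min' hex h, Nat.find_spec hex,
        fun r hr => not_not.1 (Nat.find_min hex hr)⟩
    have hsW := hst.trans ht
    have hmon : (pulls A s b : ℝ) ≤ pulls A t b := by exact_mod_cast pulls_mono b hst
    suffices 600 * L ≤ pulls A s b * μ b from
      this.trans (mul_le_mul_of_nonneg_right hmon hμb0)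
    clear hmon
    simp only [hexplore, not_forall, not_le] at hs
    obtain ⟨i, hi⟩ := hs
    have hui := (hregU i s hsW).upper_mul
    have hub := (hregU b s hsW).lower
    rw [← hpullsU s hsW hsmin] at hui hub
    have hg := (hgain i s hsW).upper_mul
    have hx : 0 ≤ (s : ℝ) * (1 / k) := by positivity
    generalize (s : ℝ) * (1 / k) = x at *
    have hn : (0 : ℝ) ≤ pulls A s i := Nat.cast_nonneg _
    generalize (pulls A s i : ℝ) = n at *
    generalize (pulls A s b : ℝ) = m at *
    rw [cParam] at hi
    have h1 := sqrt_mul_le_add hx hL.le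
    have h2 : n * μ i ≤ (2 * x + 4 * L) * μ b := mul_le_mul hui (hb i) (hμ i).1 (by positivity)
    have h3 : (x * (3 / 4) - 8 * L) * μ b ≤ m * μ b :=
      mul_le_mul_of_nonneg_right (by linarith) hμb0
    nlinarith [mul_le_of_le_one_right hL.le hμb1]
  -- a round after exploration is paid for by the increase of the potential
  have hstep : ∀ t < W, ¬ explore t → μ b - μ (A t) ≤
      37 * Real.sqrt L * ((∑ i, Real.sqrt (pulls A (t + 1) i)) - ∑ i, Real.sqrt (pulls A t i)) := by
    intro t ht h
    have hsel := hA t ht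
    rw [if_neg h] at hsel
    have hmax := ((argmaxArm_eq_iff _ _).1 hsel.symm).1 b
    simp only [ncb_index_eq] at hmax
    have hq := (le_ncb_index hL (hgain b t ht.le) (hlong t ht.le h)).trans hmax
    have hgn : gain A y t (A t) ≤ pulls A t (A t) := by
      simpa [gain] using Finset.sum_le_card_nsmul (Finset.range (pulls A t (A t)))
        (fun j => y (A t) j) 1 fun j _ => (hy _ j).2
    have := sub_le_of_le_ncb_index hL.le (hμ (A t)).1 (hgain (A t) t ht.le) hgn hq
    refine this.trans_eq ?_
    rw [← Finset.sum_sub_distrib, Finset.sum_eq_single (A t)]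
    · rw [pulls_succ, if_pos rfl]
    · intro i _ hi
      rw [pulls_succ, if_neg (Ne.symm hi), add_zero, sub_self]
    · simp
  have hpot : ∀ w ≤ W, ∑ t ∈ Finset.range w, (μ b - μ (A t)) ≤
      1 + 6745 * k * L + 37 * Real.sqrt L * ∑ i, Real.sqrt (pulls A w i) := by
    intro w hw
    induction w with
    | zero => simp only [Finset.range_zero, Finset.sum_empty]; positivity
    | succ w ih =>
      by_cases h : explore w
      · have h1 : ∑ t ∈ Finset.range (w + 1), (μ b - μ (A t)) ≤ (w + 1) * μ b := by
          simpa using Finset.sum_le_card_nsmul (Finset.range (w + 1))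
            (fun t => μ b - μ (A t)) (μ b) fun t _ => by linarith [(hμ (A t)).1]
        have h2 := hshort w (by omega) h
        have h3 : 0 ≤ 37 * Real.sqrt L * ∑ i, Real.sqrt (pulls A (w + 1) i) := by positivity
        linarith
      · rw [Finset.sum_range_succ]
        have h1 := ih (by omega)
        have h2 := hstep w (by omega) h
        linarith
  refine (hpot W le_rfl).trans ?_
  gcongr
  -- the Cauchy-Schwarz inequality
  refine Real.le_sqrt_of_sq_le ((sq_sum_le_card_mul_sum_sq).trans_eq ?_)
  simp only [Finset.card_univ, Fintype.card_fin, Nat.cast_nonneg, Real.sq_sqrt]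
  rw [← Nat.cast_sum, sum_pulls]

end Run

/-! ### The rounds of an epoch as a run of Modified NCB -/

section History

variable {k : ℕ}

theorem pullCount_eq_pulls {t : ℕ} {past : History k t} {a : ℕ → Fin k}
    (h : ∀ s : Fin t, (past s).1 = a s) (i : Fin k) : pullCount past i = pulls a t i := by
  simp only [pullCount, pulls, Finset.card_filter, h]
  exact Fin.sum_univ_eq_sum_range (fun s => if a s = i then 1 else 0) t

theorem rewardSum_eq_gain {t : ℕ} {past : History k t} {a : ℕ → Fin k} {y : Fin k → ℕ → ℝ}
    (h : ∀ s : Fin t, (past s).1 = a s)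
    (h' : ∀ s : Fin t, ((past s).2 : ℝ) = y (a s) (pulls a s (a s))) (i : Fin k) :
    rewardSum past i = gain a y t i := by
  simp only [rewardSum, gain_eq_sum, h, h']
  rw [Fin.sum_univ_eq_sum_range
    (fun s => if a s = i then y (a s) (pulls a s (a s)) else (0 : ℝ)) t]
  refine Finset.sum_congr rfl fun s _ => ?_
  split_ifs with hs
  · rw [hs]
  · rfl

namespace AnytimeAlgorithm

variable (A : AnytimeAlgorithm k)

theorem history_apply (ω : A.Seed) (Y : Fin k × ℕ → I) (t : ℕ) (s : Fin t) :
    A.history ω Y t s = (A.pulledArm s ω Y,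
      Y (A.pulledArm s ω Y, pulls (fun r => A.pulledArm r ω Y) s (A.pulledArm s ω Y))) := by
  induction t with
  | zero => exact s.elim0
  | succ t ih =>
    rw [history]
    induction s using Fin.lastCases with
    | last =>
      rw [Fin.snoc_last, pullCount_eq_pulls (a := fun r => A.pulledArm r ω Y)
        fun s => by rw [ih s]]
      rfl
    | cast s => rw [Fin.snoc_castSucc, ih s]; rfl

theorem measurable_history (t : ℕ) :
    Measurable fun p : A.Seed × (Fin k × ℕ → I) => A.history p.1 p.2 t := by
  induction t with
  | zero => exact measurable_pi_lambda _ fun s => s.elim0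
  | succ t ih =>
    have hsel : Measurable fun p : A.Seed × (Fin k × ℕ → I) =>
        A.select t p.1 (A.history p.1 p.2 t) :=
      (A.measurable_select t).comp (measurable_fst.prodMk ih)
    have hcnt : ∀ i : Fin k, Measurable fun past : History k t => pullCount past i := fun i => by
      simp only [pullCount, Finset.card_filter]
      exact Finset.measurable_sum _ fun s _ => Measurable.ite
        ((measurable_fst.comp (measurable_pi_apply s)) (measurableSet_singleton i))
        measurable_const measurable_const
    have hcnt' : Measurable fun p : A.Seed × (Fin k × ℕ → I) =>
        pullCount (A.history p.1 p.2 t) (A.select t p.1 (A.history p.1 p.2 t)) := by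
      have h : Measurable fun q : History k t × Fin k => pullCount q.1 q.2 :=
        measurable_from_prod_countable_left hcnt
      exact h.comp (ih.prodMk hsel)
    have hev : Measurable fun q : (Fin k × ℕ → I) × (Fin k × ℕ) => q.1 q.2 :=
      measurable_from_prod_countable_left fun j => measurable_pi_apply j
    refine measurable_pi_lambda _ fun s => ?_
    induction s using Fin.lastCases with
    | last =>
      simp only [history, Fin.snoc_last]
      exact hsel.prodMk (hev.comp (measurable_snd.prodMk (hsel.prodMk hcnt')))
    | cast s =>
      simp only [history, Fin.snoc_castSucc]
      exact (measurable_pi_apply s).comp ih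

theorem measurable_pulledArm (t : ℕ) :
    Measurable fun p : A.Seed × (Fin k × ℕ → I) => A.pulledArm t p.1 p.2 :=
  (A.measurable_select t).comp (measurable_fst.prodMk (A.measurable_history t))

end AnytimeAlgorithm

theorem epochOf_add {h s : ℕ} (hs : s < window h) : epochOf (epochStart h + s) = h := by
  have h1 := epochStart_eq h
  refine Nat.log_eq_of_pow_le_of_lt_pow ?_ ?_
  · change window h ≤ _; omega
  · rw [pow_succ]; change _ < window h * 2; omega

variable [NeZero k]

theorem pulledArm_of_flag {t : ℕ} {ω : (ℕ → Bool) × (ℕ → Fin k)} (Y : Fin k × ℕ → I)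
    (hω : ω.1 (epochOf t) = true) : (anytimeNCB k).pulledArm t ω Y = ω.2 t :=
  if_pos hω

/-- In an epoch in which the flag is not set, the arms are chosen by Modified NCB, run on the part
of the reward table that the earlier epochs have left unused. -/
theorem pulledArm_of_not_flag {h s : ℕ} {ω : (ℕ → Bool) × (ℕ → Fin k)} (Y : Fin k × ℕ → I)
    (hω : ω.1 h ≠ true) (hs : s < window h) {a : ℕ → Fin k}
    (ha : ∀ t, a t = (anytimeNCB k).pulledArm t ω Y) {y : Fin k → ℕ → ℝ}
    (hy : ∀ i j, y i j = Y (i, pulls a (epochStart h) i + j)) :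
    a (epochStart h + s) = open Classical in
      if ∀ i, gain (fun r => a (epochStart h + r)) y s i ≤ 420 * cParam ^ 2 * Real.log (window h)
      then ω.2 (epochStart h + s)
      else argmaxArm fun i => gain (fun r => a (epochStart h + r)) y s i /
          pulls (fun r => a (epochStart h + r)) s i + 2 * cParam *
        Real.sqrt (2 * (gain (fun r => a (epochStart h + r)) y s i /
          pulls (fun r => a (epochStart h + r)) s i) * Real.log (window h) /
          pulls (fun r => a (epochStart h + r)) s i) := by
  classical
  have hep := epochOf_add hs
  have hsub : epochStart h + s - epochStart (epochOf (epochStart h + s)) = s := by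
    rw [hep]; omega
  have hpast : ∀ r, epochHistory ((anytimeNCB k).history ω Y (epochStart h + s)) r =
      (a (epochStart h + r), Y (a (epochStart h + r),
        pulls a (epochStart h + r) (a (epochStart h + r)))) := fun r => by
    have h1 : epochHistory ((anytimeNCB k).history ω Y (epochStart h + s)) r =
        (a (epochStart (epochOf (epochStart h + s)) + r),
          Y (a (epochStart (epochOf (epochStart h + s)) + r),
            pulls a (epochStart (epochOf (epochStart h + s)) + r)
              (a (epochStart (epochOf (epochStart h + s)) + r)))) := by
      obtain rfl : a = fun t => (anytimeNCB k).pulledArm t ω Y := funext ha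
      exact (anytimeNCB k).history_apply ω Y _ _
    rw [h1]
    generalize (r : ℕ) = r'
    rw [hep]
  have hcount : ∀ i, pullCount (epochHistory ((anytimeNCB k).history ω Y (epochStart h + s))) i =
      pulls (fun r => a (epochStart h + r)) s i := fun i => by
    rw [pullCount_eq_pulls (a := fun r => a (epochStart h + r)) fun r => by rw [hpast r], hsub]
  have hsum : ∀ i, rewardSum (epochHistory ((anytimeNCB k).history ω Y (epochStart h + s))) i =
      gain (fun r => a (epochStart h + r)) y s i := fun i => by
    rw [rewardSum_eq_gain (a := fun r => a (epochStart h + r)) (y := y)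
      (fun r => by rw [hpast r]) (fun r => by rw [hpast r, hy, pulls_add]), hsub]
  rw [ha]
  change anytimeSelect k _ ω ((anytimeNCB k).history ω Y (epochStart h + s)) = _
  generalize (anytimeNCB k).history ω Y (epochStart h + s) = past at *
  unfold anytimeSelect
  rw [if_neg (by rwa [hep])]
  simp only [modifiedNCB, hsum, hep]
  congr 2
  funext i
  simp only [ncb, empMean, hsum, hcount]

end History

/-! ### Means and the law of the algorithm -/

section Law

variable {k : ℕ}

theorem mean_mem_Icc (ν : Instance k) (i : Fin k) : ν.mean i ∈ Set.Icc (0 : ℝ) 1 := by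
  refine ⟨integral_nonneg fun x => x.2.1, ?_⟩
  refine (integral_mono (integrable_of_mem_Icc measurable_subtype_coe fun x => x.2)
    (integrable_const 1) fun x => x.2.2).trans ?_
  simp

theorem exists_mean_eq_optMean [NeZero k] (ν : Instance k) :
    ∃ b, ν.mean b = ν.optMean ∧ ∀ i, ν.mean i ≤ ν.mean b := by
  obtain ⟨b, hb⟩ := Finite.exists_max ν.mean
  exact ⟨b, le_antisymm (le_ciSup (Set.finite_range _).bddAbove b) (ciSup_le hb), hb⟩

theorem measureReal_preimage_le {α β : Type*} [MeasurableSpace α] [MeasurableSpace β]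
    {P : Measure α} {Q : Measure β} [IsFiniteMeasure Q] {f : α → β} (hf : MeasurePreserving f P Q)
    (s : Set β) : P.real (f ⁻¹' s) ≤ Q.real s := by
  refine ENNReal.toReal_mono (measure_ne_top Q s) ?_
  rw [← hf.map_eq]
  exact Measure.le_map_apply hf.measurable.aemeasurable s

/-- A function with values in `[0, M]` that is at most `B` off a set `s`, which need not be
measurable, has integral at most `B + M * P s`. -/
theorem integral_le_add_mul_measureReal {α : Type*} [MeasurableSpace α] {P : Measure α}
    [IsProbabilityMeasure P] {f : α → ℝ} (hf : Measurable f) {B M : ℝ} (hB : 0 ≤ B)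
    (hfM : ∀ x, f x ∈ Set.Icc 0 M) {s : Set α} (hs : ∀ x ∉ s, f x ≤ B) :
    ∫ x, f x ∂P ≤ B + M * P.real s := by
  have hm : MeasurableSet {x | B < f x} := measurableSet_lt measurable_const hf
  have hM : 0 ≤ M := by
    obtain ⟨x⟩ : Nonempty α := nonempty_of_isProbabilityMeasure P
    exact (hfM x).1.trans (hfM x).2
  have hi : Integrable ({x | B < f x}.indicator fun _ => M) P :=
    (integrable_const M).indicator hm
  calc ∫ x, f x ∂P ≤ ∫ x, (B + {x | B < f x}.indicator (fun _ => M) x) ∂P := by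
        refine integral_mono (integrable_of_mem_Icc hf hfM) ((integrable_const B).add hi)
          fun x => ?_
        by_cases hx : B < f x
        · simp only [Set.indicator, Set.mem_ofPred_eq, hx, if_true]
          linarith [(hfM x).2]
        · simp only [Set.indicator, Set.mem_ofPred_eq, hx, if_false]
          linarith
    _ = B + M * P.real {x | B < f x} := by
        rw [integral_add (integrable_const B) hi, integral_indicator_const _ hm]
        simp [mul_comm]
    _ ≤ B + M * P.real s := by
        gcongr
        · exact measure_ne_top P s
        · intro x hx
          by_contra hc
          exact absurd (hs x hc) (not_le.2 hx)

theorem measureReal_not_regularSeq_table_le (ν : Instance k) (i : Fin k) {W : ℕ} (hW : 1 ≤ W) :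
    (Measure.infinitePi fun p : Fin k × ℕ => (ν p.1 : Measure I)).real
      {Y | ¬ RegularSeq (fun j => (Y (i, j) : ℝ)) (ν.mean i) W} ≤ 6 / (W : ℝ) ^ 2 := by
  have hg : Measurable fun x : I => (x : ℝ) := measurable_subtype_coe
  refine measureReal_not_regularSeq_le (X := fun j (Y : Fin k × ℕ → I) => (Y (i, j) : ℝ))
    (fun j => hg.comp (measurable_pi_apply _)) (fun j Y => (Y (i, j)).2)
    ((iIndepFun_infinitePi (P := fun p : Fin k × ℕ => (ν p.1 : Measure I)) fun _ => hg).precomp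
      (Prod.mk_right_injective i)) (fun j => ?_) hW
  have h1 := integral_map
    (μ := Measure.infinitePi fun p : Fin k × ℕ => (ν p.1 : Measure I))
    (measurable_pi_apply (i, j)).aemeasurable hg.aestronglyMeasurable
  rw [Measure.infinitePi_map_eval] at h1
  exact h1.symm

variable [NeZero k]

/-- The law of the seed of the anytime algorithm and of the reward table. It is the measure
`(anytimeNCB k).law ν`, with the type of the seeds written out. -/
noncomputable def anytimeLaw (ν : Instance k) :
    Measure (((ℕ → Bool) × (ℕ → Fin k)) × (Fin k × ℕ → I)) :=
  (seedMeasure k).prod (Measure.infinitePi fun p : Fin k × ℕ => (ν p.1 : Measure I))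

instance (ν : Instance k) : IsProbabilityMeasure (anytimeLaw ν) := by
  unfold anytimeLaw; infer_instance

/-- The arm that the anytime algorithm pulls after `t` rounds, as a random variable. -/
noncomputable def anytimeArm (t : ℕ) (p : ((ℕ → Bool) × (ℕ → Fin k)) × (Fin k × ℕ → I)) : Fin k :=
  (anytimeNCB k).pulledArm t p.1 p.2

theorem expectedReward_eq (ν : Instance k) (t : ℕ) :
    (anytimeNCB k).expectedReward ν t = ∫ p, ν.mean (anytimeArm t p) ∂(anytimeLaw ν) := rfl

theorem measurable_mean_anytimeArm (ν : Instance k) (t : ℕ) :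
    Measurable fun p => ν.mean (anytimeArm t p) :=
  (measurable_of_finite ν.mean).comp ((anytimeNCB k).measurable_pulledArm t)

theorem measurePreserving_flag (k : ℕ) [NeZero k] (h : ℕ) :
    MeasurePreserving (fun ω : (ℕ → Bool) × (ℕ → Fin k) => ω.1 h) (seedMeasure k)
      (bernoulliMeasure true false (exploreProb h)) :=
  (measurePreserving_eval_infinitePi
    (fun h => bernoulliMeasure true false (exploreProb h)) h).comp measurePreserving_fst

theorem measurePreserving_draws (k : ℕ) [NeZero k] :
    MeasurePreserving (fun ω : (ℕ → Bool) × (ℕ → Fin k) => ω.2) (seedMeasure k)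
      (Measure.infinitePi fun _ => (PMF.uniformOfFintype (Fin k)).toMeasure) :=
  measurePreserving_snd

theorem measureReal_flag (h : ℕ) :
    (bernoulliMeasure true false (exploreProb h)).real {true} = 1 / (window h : ℝ) ^ 2 := by
  rw [bernoulliMeasure_real_apply_of_mem_of_notMem _ (measurableSet_singleton _) (by simp)
    (by simp)]
  rfl

theorem measureReal_draw (i : Fin k) :
    (PMF.uniformOfFintype (Fin k)).toMeasure.real {i} = 1 / k := by
  rw [measureReal_def, PMF.toMeasure_apply_singleton _ _ (measurableSet_singleton i),
    PMF.uniformOfFintype_apply]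
  simp

theorem measurePreserving_seed (ν : Instance k) :
    MeasurePreserving (fun p : ((ℕ → Bool) × (ℕ → Fin k)) × (Fin k × ℕ → I) => p.1)
      (anytimeLaw ν) (seedMeasure k) :=
  measurePreserving_fst

theorem measurePreserving_table (ν : Instance k) :
    MeasurePreserving (fun p : ((ℕ → Bool) × (ℕ → Fin k)) × (Fin k × ℕ → I) => p.2)
      (anytimeLaw ν) (Measure.infinitePi fun p : Fin k × ℕ => (ν p.1 : Measure I)) :=
  measurePreserving_snd

theorem measureReal_not_regularSeq_draws_le (i : Fin k) {W : ℕ} (hW : 1 ≤ W) :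
    (Measure.infinitePi fun _ : ℕ => (PMF.uniformOfFintype (Fin k)).toMeasure).real
      {U | ¬ RegularSeq (fun j => if U j = i then 1 else 0) (1 / k) W} ≤ 6 / (W : ℝ) ^ 2 := by
  have hg : Measurable fun u : Fin k => if u = i then (1 : ℝ) else 0 := measurable_of_finite _
  refine measureReal_not_regularSeq_le (X := fun j (U : ℕ → Fin k) => if U j = i then (1 : ℝ) else 0)
    (fun j => hg.comp (measurable_pi_apply j)) (fun j U => ?_)
    (iIndepFun_infinitePi fun _ => hg) (fun j => ?_) hW
  · split_ifs <;> simp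
  · have h1 := integral_map
      (μ := Measure.infinitePi fun _ : ℕ => (PMF.uniformOfFintype (Fin k)).toMeasure)
      (measurable_pi_apply j).aemeasurable hg.aestronglyMeasurable
    rw [Measure.infinitePi_map_eval] at h1
    rw [← h1, ← measureReal_draw i, ← integral_indicator_one (measurableSet_singleton i)]
    exact integral_congr_ae (Filter.Eventually.of_forall fun u => by simp [Set.indicator])

/-! ### Regret of an epoch -/

/-- The event that the seed and the reward table do not let Modified NCB perform well in epoch
`h`: the flag of the epoch is set, or some draws or some rewards are far from their means. -/
def badEvent (ν : Instance k) (h : ℕ) : Set (((ℕ → Bool) × (ℕ → Fin k)) × (Fin k × ℕ → I)) :=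
  {p | p.1.1 h = true} ∪
    ((⋃ i : Fin k,
      {p | ¬ RegularSeq (fun j => if p.1.2 j = i then 1 else 0) (1 / k) (window h)}) ∪
    ⋃ i : Fin k, {p | ¬ RegularSeq (fun j => (p.2 (i, j) : ℝ)) (ν.mean i) (window h)})

theorem one_le_window (h : ℕ) : 1 ≤ window h := Nat.one_le_two_pow

theorem measureReal_badEvent_le (ν : Instance k) (h : ℕ) :
    (anytimeLaw ν).real (badEvent ν h) ≤ (1 + 12 * k) / (window h : ℝ) ^ 2 := by
  have h1 : (anytimeLaw ν).real {p | p.1.1 h = true} ≤ 1 / (window h : ℝ) ^ 2 :=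
    (measureReal_preimage_le ((measurePreserving_flag k h).comp (measurePreserving_seed ν))
      {true}).trans_eq (measureReal_flag h)
  have h2 : ∀ i : Fin k, (anytimeLaw ν).real
      {p | ¬ RegularSeq (fun j => if p.1.2 j = i then 1 else 0) (1 / k) (window h)} ≤
      6 / (window h : ℝ) ^ 2 := fun i =>
    (measureReal_preimage_le ((measurePreserving_draws k).comp (measurePreserving_seed ν))
      {U | ¬ RegularSeq (fun j => if U j = i then 1 else 0) (1 / k) (window h)}).trans
      (measureReal_not_regularSeq_draws_le i (one_le_window h))
  have h3 : ∀ i : Fin k, (anytimeLaw ν).real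
      {p | ¬ RegularSeq (fun j => (p.2 (i, j) : ℝ)) (ν.mean i) (window h)} ≤
      6 / (window h : ℝ) ^ 2 := fun i =>
    (measureReal_preimage_le (measurePreserving_table ν)
      {Y | ¬ RegularSeq (fun j => (Y (i, j) : ℝ)) (ν.mean i) (window h)}).trans
      (measureReal_not_regularSeq_table_le ν i (one_le_window h))
  have h2' := (measureReal_iUnion_fintype_le (μ := anytimeLaw ν) _).trans
    (Finset.sum_le_card_nsmul Finset.univ _ _ fun i _ => h2 i)
  have h3' := (measureReal_iUnion_fintype_le (μ := anytimeLaw ν) _).trans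
    (Finset.sum_le_card_nsmul Finset.univ _ _ fun i _ => h3 i)
  simp only [Finset.card_univ, Fintype.card_fin, nsmul_eq_mul] at h2' h3'
  refine (measureReal_union_le _ _).trans
    ((add_le_add h1 ((measureReal_union_le _ _).trans (add_le_add h2' h3'))).trans_eq ?_)
  ring

/-- Outside the bad event of an epoch, the regret of the epoch is that of Modified NCB. -/
theorem sum_regret_le_of_notMem_badEvent (ν : Instance k) {h : ℕ} (hh : h ≠ 0)
    {p : ((ℕ → Bool) × (ℕ → Fin k)) × (Fin k × ℕ → I)} (hp : p ∉ badEvent ν h) :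
    ∑ s ∈ Finset.range (window h),
      (ν.optMean - ν.mean (anytimeArm (epochStart h + s) p)) ≤
    1 + 6745 * k * Real.log (window h) +
      37 * Real.sqrt (Real.log (window h)) * Real.sqrt (k * window h) := by
  obtain ⟨b, hb, hmax⟩ := exists_mean_eq_optMean ν
  obtain ⟨⟨f, U⟩, Y⟩ := p
  simp only [badEvent, Set.mem_union, Set.mem_iUnion, Set.mem_ofPred_eq, not_or, not_exists,
    not_not] at hp
  obtain ⟨hf, hU, hY⟩ := hp
  have hstart : epochStart h < window h := by have := epochStart_eq h; omega
  set a : ℕ → Fin k := fun t => (anytimeNCB k).pulledArm t (f, U) Y with ha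
  rw [← hb]
  refine sum_regret_le (A := fun s => a (epochStart h + s)) (U := fun s => U (epochStart h + s))
    (y := fun i j => Y (i, pulls a (epochStart h) i + j)) ?_ (mean_mem_Icc ν) hmax
    (fun i j => (Y _).2) (fun i m hm => ?_) (fun i m hm => ?_) fun s hs => ?_
  · exact Nat.le_self_pow hh 2
  · rw [cast_pulls]
    exact hU i _ (Finset.mem_range.2 hstart) m (Finset.mem_range.2 (by omega))
  · exact hY i _ (Finset.mem_range.2 ((pulls_le _ i).trans_lt hstart)) m
      (Finset.mem_range.2 (by omega))
  · exact pulledArm_of_not_flag Y hf hs (fun _ => rfl) fun _ _ => rfl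

theorem integrable_mean_anytimeArm (ν : Instance k) (t : ℕ) :
    Integrable (fun p => ν.mean (anytimeArm t p)) (anytimeLaw ν) :=
  integrable_of_mem_Icc (measurable_mean_anytimeArm ν t) fun _ => mean_mem_Icc ν _

theorem sum_expected_regret_le (ν : Instance k) {h : ℕ} (hh : h ≠ 0) :
    ∑ s ∈ Finset.range (window h),
      (ν.optMean - (anytimeNCB k).expectedReward ν (epochStart h + s)) ≤
    1 + 6745 * k * Real.log (window h) +
      37 * Real.sqrt (Real.log (window h)) * Real.sqrt (k * window h) +
      (1 + 12 * k) / window h := by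
  obtain ⟨b, hb, hmax⟩ := exists_mean_eq_optMean ν
  have hb1 := (mean_mem_Icc ν b).2
  have hW : (1 : ℝ) ≤ window h := by exact_mod_cast one_le_window h
  have hlog := Real.log_nonneg hW
  have heq : ∑ s ∈ Finset.range (window h),
      (ν.optMean - (anytimeNCB k).expectedReward ν (epochStart h + s)) =
      ∫ p, ∑ s ∈ Finset.range (window h),
        (ν.optMean - ν.mean (anytimeArm (epochStart h + s) p))
        ∂(anytimeLaw ν) := by
    rw [integral_finsetSum]
    · refine Finset.sum_congr rfl fun s _ => ?_
      rw [integral_sub (integrable_const _) (integrable_mean_anytimeArm ν _)]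
      simp [expectedReward_eq]
    · exact fun s _ => (integrable_const _).sub (integrable_mean_anytimeArm ν _)
  rw [heq]
  have hterm : ∀ i, ν.optMean - ν.mean i ∈ Set.Icc (0 : ℝ) 1 := fun i => by
    rw [← hb]
    exact ⟨by linarith [hmax i], by linarith [(mean_mem_Icc ν i).1]⟩
  refine (integral_le_add_mul_measureReal (M := window h) (s := badEvent ν h) ?_ ?_
    (fun p => ⟨?_, ?_⟩) fun p hp => sum_regret_le_of_notMem_badEvent ν hh hp).trans ?_
  · exact Finset.measurable_sum _ fun s _ => measurable_const.sub (measurable_mean_anytimeArm ν _)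
  · positivity
  · exact Finset.sum_nonneg fun s _ => (hterm _).1
  · refine (Finset.sum_le_card_nsmul _ _ 1 fun s _ => (hterm _).2).trans_eq ?_
    simp
  · have h1 := mul_le_mul_of_nonneg_left (measureReal_badEvent_le ν h)
      (by linarith : (0 : ℝ) ≤ window h)
    have h2 : (window h : ℝ) * ((1 + 12 * k) / (window h : ℝ) ^ 2) = (1 + 12 * k) / window h := by
      field_simp
    linarith

theorem expectedReward_le (ν : Instance k) (t : ℕ) :
    (anytimeNCB k).expectedReward ν t ≤ ν.optMean := by
  obtain ⟨b, hb, hmax⟩ := exists_mean_eq_optMean ν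
  rw [expectedReward_eq]
  refine (integral_mono (integrable_mean_anytimeArm ν t) (integrable_const ν.optMean)
    fun p => hb ▸ hmax _).trans ?_
  simp

/-- The forced exploration keeps the expected reward of a round polynomially close to the optimal
mean: the flag is set and the draw is an optimal arm with probability `1 / (k W²)`. -/
theorem le_expectedReward (ν : Instance k) (t : ℕ) :
    ν.optMean / (k * (t + 1) ^ 2) ≤ (anytimeNCB k).expectedReward ν t := by
  obtain ⟨b, hb, -⟩ := exists_mean_eq_optMean ν
  have hk : (0 : ℝ) < k := by exact_mod_cast Nat.pos_of_ne_zero (NeZero.ne k)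
  have hb0 := (mean_mem_Icc ν b).1
  have hW : (1 : ℝ) ≤ window (epochOf t) := by exact_mod_cast one_le_window _
  have hWt : (window (epochOf t) : ℝ) ≤ t + 1 := by
    exact_mod_cast Nat.pow_log_le_self 2 (Nat.succ_ne_zero t)
  set F : Set (((ℕ → Bool) × (ℕ → Fin k)) × (Fin k × ℕ → I)) :=
    Prod.fst ⁻¹' (((fun f => f (epochOf t)) ⁻¹' {true}) ×ˢ ((fun U => U t) ⁻¹' {b})) with hF
  have hm1 : MeasurableSet ((fun f : ℕ → Bool => f (epochOf t)) ⁻¹' {true}) :=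
    measurable_pi_apply _ (measurableSet_singleton _)
  have hm2 : MeasurableSet ((fun U : ℕ → Fin k => U t) ⁻¹' {b}) :=
    measurable_pi_apply _ (measurableSet_singleton _)
  have hFm : MeasurableSet F := measurable_fst (hm1.prod hm2)
  have hFp : (anytimeLaw ν).real F = 1 / (window (epochOf t) : ℝ) ^ 2 * (1 / k) := by
    rw [← measureReal_flag, ← measureReal_draw b]
    refine ((measurePreserving_seed ν).measureReal_preimage
      (hm1.prod hm2).nullMeasurableSet).trans ?_
    rw [seedMeasure, measureReal_prod_prod]
    congr 1
    · exact (measurePreserving_eval_infinitePi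
        (fun h => bernoulliMeasure true false (exploreProb h)) (epochOf t)).measureReal_preimage
        (measurableSet_singleton _).nullMeasurableSet
    · exact (measurePreserving_eval_infinitePi
        (fun _ => (PMF.uniformOfFintype (Fin k)).toMeasure) t).measureReal_preimage
        (measurableSet_singleton _).nullMeasurableSet
  calc ν.optMean / (k * (t + 1) ^ 2)
      ≤ ν.optMean / (k * (window (epochOf t) : ℝ) ^ 2) := by rw [← hb]; gcongr
    _ = ∫ p, F.indicator (fun _ => ν.optMean) p ∂(anytimeLaw ν) := by
        rw [integral_indicator_const _ hFm, hFp, smul_eq_mul]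
        field_simp
    _ ≤ _ := by
        rw [expectedReward_eq]
        refine integral_mono ((integrable_const _).indicator hFm) (integrable_mean_anytimeArm ν t)
          fun p => ?_
        by_cases hp : p ∈ F
        · rw [Set.indicator_of_mem hp]
          obtain ⟨h1, h2⟩ := hp
          have h3 : anytimeArm t p = b :=
            (pulledArm_of_flag p.2 h1).trans h2
          dsimp only
          rw [h3, hb]
        · rw [Set.indicator_of_notMem hp]
          exact (mean_mem_Icc ν _).1

end Law

/-! ### From expected regret to Nash regret -/

/-- The geometric mean of numbers in `[m / T³, m]` falls short of `m` by at most the average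
shortfall, up to a logarithmic factor. -/
theorem sub_rpow_prod_le {m : ℝ} (hm : 0 < m) {T : ℕ} (hT : 1 ≤ Real.log T) {a : ℕ → ℝ}
    (ha : ∀ t < T, m / (T : ℝ) ^ 3 ≤ a t) (ha' : ∀ t < T, a t ≤ m) :
    m - (∏ t ∈ Finset.range T, a t) ^ (1 / (T : ℝ)) ≤
      6 * Real.log T / T * ∑ t ∈ Finset.range T, (m - a t) := by
  have hT0 : (0 : ℝ) < T := by
    rcases Nat.eq_zero_or_pos T with rfl | h
    · norm_num at hT
    · exact_mod_cast h
  have hpos : ∀ t ∈ Finset.range T, 0 < a t := fun t ht =>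
    (by positivity : 0 < m / (T : ℝ) ^ 3).trans_le (ha t (Finset.mem_range.1 ht))
  have hlog : ∀ t ∈ Finset.range T,
      Real.log m - 6 * Real.log T * (m - a t) / m ≤ Real.log (a t) := by
    intro t ht
    have hx0 := hpos t ht
    have h1 : Real.log (a t) = Real.log m + Real.log (a t / m) := by
      rw [Real.log_div hx0.ne' hm.ne']; ring
    have hlow : 1 / (T : ℝ) ^ 3 ≤ a t / m := by
      rw [le_div_iff₀ hm, one_div, inv_mul_eq_div]
      exact ha t (Finset.mem_range.1 ht)
    have hup : a t / m ≤ 1 := (div_le_one hm).2 (ha' t (Finset.mem_range.1 ht))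
    have h2 : (m - a t) / m = 1 - a t / m := by field_simp
    rw [h1, mul_div_assoc, h2]
    have hx : 0 < a t / m := by positivity
    generalize a t / m = x at *
    suffices -(6 * Real.log T * (1 - x)) ≤ Real.log x by linarith
    rcases le_total (1 / 2) x with hc | hc
    · refine le_trans ?_ (Real.one_sub_inv_le_log_of_pos hx)
      have h3 : 1 - x⁻¹ = -((1 - x) / x) := by field_simp; ring
      have h4 : (1 - x) / x ≤ 2 * (1 - x) := by
        rw [div_le_iff₀ hx]; nlinarith
      nlinarith
    · have h3 := Real.log_le_log (by positivity) hlow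
      rw [one_div, Real.log_inv, Real.log_pow] at h3
      push_cast at h3
      nlinarith
  have hgeo : (∏ t ∈ Finset.range T, a t) ^ (1 / (T : ℝ)) =
      Real.exp ((∑ t ∈ Finset.range T, Real.log (a t)) * (1 / T)) := by
    rw [Real.rpow_def_of_pos (Finset.prod_pos hpos), Real.log_prod fun t ht => (hpos t ht).ne']
  have hsum := Finset.sum_le_sum hlog
  rw [Finset.sum_sub_distrib, ← Finset.sum_div, ← Finset.mul_sum, Finset.sum_const,
    Finset.card_range, nsmul_eq_mul] at hsum
  rw [hgeo]
  set S := ∑ t ∈ Finset.range T, (m - a t)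
  have h1 : Real.log m + -(6 * Real.log T * S / (m * T)) ≤
      (∑ t ∈ Finset.range T, Real.log (a t)) * (1 / T) := by
    rw [mul_one_div, le_div_iff₀ hT0]
    refine le_trans (le_of_eq ?_) hsum
    field_simp
    ring
  have h2 := Real.exp_le_exp.2 h1
  rw [Real.exp_add, Real.exp_log hm] at h2
  have h3 := mul_le_mul_of_nonneg_left (Real.add_one_le_exp (-(6 * Real.log T * S / (m * T)))) hm.le
  have h4 : m * (-(6 * Real.log T * S / (m * T)) + 1) = m - 6 * Real.log T / T * S := by
    field_simp
    ring
  linarith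

theorem sum_range_epochStart (f : ℕ → ℝ) (n : ℕ) :
    ∑ t ∈ Finset.range (epochStart n), f t =
      ∑ h ∈ Finset.range n, ∑ s ∈ Finset.range (window h), f (epochStart h + s) := by
  induction n with
  | zero => simp [epochStart]
  | succ n ih =>
    rw [Finset.sum_range_succ, ← ih, ← Finset.sum_range_add]
    congr 2
    simp [epochStart, Finset.sum_range_succ]

theorem sum_sqrt_window_le (n : ℕ) :
    ∑ h ∈ Finset.range n, Real.sqrt (window h) ≤ 3 * Real.sqrt (window n) := by
  induction n with
  | zero => simp
  | succ n ih =>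
    rw [Finset.sum_range_succ]
    have h1 : 4 / 3 * Real.sqrt (window n) ≤ Real.sqrt (window (n + 1)) := by
      refine Real.le_sqrt_of_sq_le ?_
      rw [mul_pow, Real.sq_sqrt (Nat.cast_nonneg _)]
      simp only [window, pow_succ]
      push_cast
      nlinarith [(by positivity : (0 : ℝ) < 2 ^ n)]
    linarith

variable {k : ℕ} [NeZero k]

theorem sum_expected_regret_le_sqrt (ν : Instance k) {h T : ℕ} (hT : 1 ≤ Real.log T)
    (hWT : window h ≤ T) :
    ∑ s ∈ Finset.range (window h),
      (ν.optMean - (anytimeNCB k).expectedReward ν (epochStart h + s)) ≤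
    7000 * Real.sqrt (k * Real.log T) * Real.sqrt (window h) := by
  have hk : (1 : ℝ) ≤ k := by exact_mod_cast Nat.one_le_iff_ne_zero.2 (NeZero.ne k)
  have hW : (1 : ℝ) ≤ window h := by exact_mod_cast one_le_window h
  have hlog0 := Real.log_nonneg hW
  have hlog : Real.log (window h) ≤ Real.log T :=
    Real.log_le_log (by linarith) (by exact_mod_cast hWT)
  have hkL : 1 ≤ k * Real.log T := by nlinarith
  have htriv : ∑ s ∈ Finset.range (window h),
      (ν.optMean - (anytimeNCB k).expectedReward ν (epochStart h + s)) ≤ window h := by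
    obtain ⟨b, hb, -⟩ := exists_mean_eq_optMean ν
    refine (Finset.sum_le_card_nsmul _ _ 1 fun s _ => ?_).trans_eq (by simp)
    have h1 := (mean_mem_Icc ν b).2
    have h2 : 0 ≤ (anytimeNCB k).expectedReward ν (epochStart h + s) :=
      integral_nonneg fun p => (mean_mem_Icc ν _).1
    linarith
  rw [mul_assoc, ← Real.sqrt_mul (by linarith)]
  have hWS : (window h : ℝ) ≤ k * Real.log T →
      (window h : ℝ) ≤ Real.sqrt (k * Real.log T * window h) := fun hc =>
    Real.le_sqrt_of_sq_le (by nlinarith)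
  -- for `W ≤ k log T`, and in the epoch of length one, the trivial bound `W` suffices
  rcases le_total (window h : ℝ) (k * Real.log T) with hc | hc
  · linarith [hWS hc, Real.sqrt_nonneg (k * Real.log T * window h)]
  rcases eq_or_ne h 0 with rfl | hh
  · have h1 : (window 0 : ℝ) = 1 := by simp [window]
    have h2 := hWS (h1 ▸ hkL)
    linarith [Real.sqrt_nonneg (k * Real.log T * window 0)]
  have h1 := sum_expected_regret_le ν hh
  have h2 : k * Real.log (window h) ≤ Real.sqrt (k * Real.log T * window h) := by
    refine Real.le_sqrt_of_sq_le ?_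
    have h3 : k * Real.log (window h) ≤ k * Real.log T := by gcongr
    have h4 : 0 ≤ k * Real.log (window h) := by positivity
    nlinarith
  have h3 : Real.sqrt (Real.log (window h)) * Real.sqrt (k * window h) ≤
      Real.sqrt (k * Real.log T * window h) := by
    rw [← Real.sqrt_mul hlog0]
    refine Real.sqrt_le_sqrt ?_
    have h4 : 0 ≤ (k : ℝ) * window h := by positivity
    nlinarith
  have h4 : 1 ≤ Real.sqrt (k * Real.log T * window h) := Real.one_le_sqrt.2 (by nlinarith)
  have h5 : (1 + 12 * k) / (window h : ℝ) ≤ 13 := by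
    rw [div_le_iff₀ (by linarith)]
    nlinarith
  linarith

/-- The expected regret of the anytime algorithm is `O(√(k T log T))`. -/
theorem sum_range_expected_regret_le (ν : Instance k) {T : ℕ} (hT : 1 ≤ Real.log T) :
    ∑ t ∈ Finset.range T, (ν.optMean - (anytimeNCB k).expectedReward ν t) ≤
      35000 * Real.sqrt (k * Real.log T * T) := by
  have hT0 : T ≠ 0 := by rintro rfl; norm_num at hT
  have hle : window (Nat.log 2 T) ≤ T := Nat.pow_log_le_self 2 hT0
  have hlt : T < window (Nat.log 2 T + 1) := Nat.lt_pow_succ_log_self one_lt_two T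
  generalize Nat.log 2 T = H at *
  have hstart := epochStart_eq (H + 1)
  have h2 : window (H + 1) = 2 * window H := by simp [window, pow_succ, mul_comm]
  have hsqrt : Real.sqrt (window (H + 1)) ≤ 3 / 2 * Real.sqrt T := by
    refine Real.sqrt_le_iff.2 ⟨by positivity, ?_⟩
    rw [mul_pow, Real.sq_sqrt (Nat.cast_nonneg _), h2]
    have : (window H : ℝ) ≤ T := by exact_mod_cast hle
    push_cast
    linarith [(Nat.cast_nonneg T : (0 : ℝ) ≤ T)]
  -- all rounds have nonnegative regret, so that the last epoch may be completed
  calc ∑ t ∈ Finset.range T, (ν.optMean - (anytimeNCB k).expectedReward ν t)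
      ≤ ∑ t ∈ Finset.range (epochStart (H + 1)),
          (ν.optMean - (anytimeNCB k).expectedReward ν t) :=
        Finset.sum_le_sum_of_subset_of_nonneg (Finset.range_mono (by omega))
          fun t _ _ => sub_nonneg.2 (expectedReward_le ν t)
    _ ≤ ∑ h ∈ Finset.range (H + 1), 7000 * Real.sqrt (k * Real.log T) * Real.sqrt (window h) := by
        rw [sum_range_epochStart]
        refine Finset.sum_le_sum fun h hh => sum_expected_regret_le_sqrt ν hT ?_
        exact (Nat.pow_le_pow_right two_pos
          (Nat.lt_succ_iff.1 (Finset.mem_range.1 hh))).trans hle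
    _ ≤ 7000 * Real.sqrt (k * Real.log T) * (3 * (3 / 2 * Real.sqrt T)) := by
        rw [← Finset.mul_sum]
        gcongr
        exact (sum_sqrt_window_le _).trans (by linarith)
    _ ≤ 35000 * Real.sqrt (k * Real.log T * T) := by
        have hmul : Real.sqrt (k * Real.log T * T) = Real.sqrt (k * Real.log T) * Real.sqrt T :=
          Real.sqrt_mul (by positivity) _
        rw [hmul]
        have : 0 ≤ Real.sqrt (k * Real.log T) * Real.sqrt T := by positivity
        linarith

theorem nashRegret_le (ν : Instance k) {T : ℕ} (hT : 1 ≤ Real.log T) :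
    (anytimeNCB k).nashRegret ν T ≤
      210000 * (Real.sqrt (k * Real.log T / T) * Real.log T) := by
  obtain ⟨b, hb, -⟩ := exists_mean_eq_optMean ν
  have hk : (0 : ℝ) < k := by exact_mod_cast Nat.pos_of_ne_zero (NeZero.ne k)
  have hT0 : (0 : ℝ) < T := by
    rcases Nat.eq_zero_or_pos T with rfl | h
    · norm_num at hT
    · exact_mod_cast h
  have htriv : (anytimeNCB k).nashRegret ν T ≤ ν.optMean := by
    refine sub_le_self _ (Real.rpow_nonneg (Finset.prod_nonneg fun t _ => ?_) _)
    exact integral_nonneg fun p => (mean_mem_Icc ν _).1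
  have hb1 := (mean_mem_Icc ν b).2
  rcases (hb ▸ (mean_mem_Icc ν b).1 : 0 ≤ ν.optMean).eq_or_lt with h0 | hpos
  · exact htriv.trans (h0 ▸ by positivity)
  -- for `k > T` the bound exceeds `1`
  rcases lt_or_ge T k with hkT | hkT
  · have h1 : 1 ≤ Real.sqrt (k * Real.log T / T) := by
      refine Real.one_le_sqrt.2 ?_
      rw [one_le_div hT0]
      have : (T : ℝ) ≤ k := by exact_mod_cast hkT.le
      nlinarith
    have h2 : 1 ≤ Real.sqrt (k * Real.log T / T) * Real.log T :=
      one_le_mul_of_one_le_of_one_le h1 hT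
    linarith
  have hkT' : (k : ℝ) ≤ T := by exact_mod_cast hkT
  have hgeo := sub_rpow_prod_le hpos hT (a := (anytimeNCB k).expectedReward ν) (fun t ht => ?_)
    fun t _ => expectedReward_le ν t
  · refine hgeo.trans ((mul_le_mul_of_nonneg_left (sum_range_expected_regret_le ν hT)
      (by positivity)).trans_eq ?_)
    have h1 : k * Real.log T * T = k * Real.log T / T * (T : ℝ) ^ 2 := by field_simp
    rw [h1, Real.sqrt_mul (by positivity), Real.sqrt_sq hT0.le]
    field_simp
    ring
  · refine le_trans ?_ (le_expectedReward ν t)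
    have ht' : (t : ℝ) + 1 ≤ T := by exact_mod_cast ht
    refine div_le_div_of_nonneg_left hpos.le (by positivity) ?_
    calc (k : ℝ) * (t + 1) ^ 2 ≤ T * (T : ℝ) ^ 2 := by gcongr
      _ = (T : ℝ) ^ 3 := by ring

end NashBandit

theorem theorem4 :
    ∃ C : ℝ, 0 < C ∧ ∃ T₀ : ℕ, ∀ (k : ℕ) [NeZero k] (ν : NashBandit.Instance k) (T : ℕ), T₀ ≤ T →
      (NashBandit.anytimeNCB k).nashRegret ν T ≤
        C * (Real.sqrt (k * Real.log T / T) * Real.log T) := by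
  refine ⟨210000, by norm_num, 3, fun k _ ν T hT => NashBandit.nashRegret_le ν ?_⟩
  rw [Real.le_log_iff_exp_le (by positivity)]
  have h : (3 : ℝ) ≤ T := by exact_mod_cast hT
  linarith [Real.exp_one_lt_d9]
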